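/- There are absolute constants $0<\theta_-<\theta_+<2$, $c>0$ and $C>0$ (in particular, independent of $t,m,n,k$) such that the following holds. Let $t>1$ be real, let $m,n,k$ be integers with $1\le k\le n$, and suppose that $$m\;\ge\; C\,t\,k\,\log(en/k),$$ or that $n\ge 2k$ and $m\ge C\,t\,k\,\log(n/k)$. Let $A\in\mathbb R^{m\times n}$ be a Gaussian random matrix, that is, its entries are independent with distribution $\mathcal N(0,1/m)$. Then, with probability at least $1-\exp(-cm/2)$, the matrix $A$ satisfies the Strong Restricted Isometry Property (SRIP) of order $t\cdot k$ and levels $\theta_-,\theta_+$, that is, $$\theta_-\|x\|_2^2\;\le\;\min_{I\subseteq[m],\,|I|\ge m/2}\|A_Ix\|_2^2\;\le\;\max_{I\subseteq[m],\,|I|\ge m/2}\|A_Ix\|_2^2\;\le\;\theta_+\|x\|_2^2$$ for all $x\in\mathbb R^n$ with at most $tk$ nonzero entries, where $[m]=\{1,\dots,m\}$ and $A_I$ is the submatrix of $A$ formed by the rows with indices in $I$. -/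

import Mathlib

open MeasureTheory ProbabilityTheory
open scoped NNReal

/-- The support of `x` has at most `s` elements. The order `s` is a real number since orders of the
form `t * k` with `t` real are used. -/
def IsSparse {n : ℕ} (s : ℝ) (x : EuclideanSpace ℝ (Fin n)) : Prop :=
  ((Finset.univ.filter fun j => x j ≠ 0).card : ℝ) ≤ s

/-- The submatrix `A_I` that keeps only the rows of `A` with index in `I`. -/
def rowSubmatrix {m n : ℕ} (A : Matrix (Fin m) (Fin n) ℝ) (I : Finset (Fin m)) :
    Matrix I (Fin n) ℝ :=
  A.submatrix (fun i : I => (i : Fin m)) id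

/-- The squared Euclidean norm `‖A_I x‖₂²`. -/
noncomputable def rowNormSq {m n : ℕ} (A : Matrix (Fin m) (Fin n) ℝ) (I : Finset (Fin m))
    (x : EuclideanSpace ℝ (Fin n)) : ℝ :=
  ‖WithLp.toLp 2 ((rowSubmatrix A I).mulVec x.ofLp)‖ ^ 2

/-- The strong restricted isometry property of order `s` and levels `θm, θp ∈ (0, 2)`. The bounds on
the minimum and on the maximum over the (finite, nonempty) family of all `I` with `|I| ≥ m / 2` are
written as bounds for every such `I`. -/
structure SRIP {m n : ℕ} (A : Matrix (Fin m) (Fin n) ℝ) (s θm θp : ℝ) : Prop where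
  lower_mem : θm ∈ Set.Ioo (0 : ℝ) 2
  upper_mem : θp ∈ Set.Ioo (0 : ℝ) 2
  bounds : ∀ x : EuclideanSpace ℝ (Fin n), IsSparse s x →
    ∀ I : Finset (Fin m), (m : ℝ) / 2 ≤ (I.card : ℝ) →
      θm * ‖x‖ ^ 2 ≤ rowNormSq A I x ∧ rowNormSq A I x ≤ θp * ‖x‖ ^ 2

/-- `A` is an `m × n` Gaussian random matrix: its entries are independent with law `N(0, 1/m)`. -/
structure IsGaussianMatrix {Ω : Type*} [MeasurableSpace Ω] {m n : ℕ}
    (A : Ω → Matrix (Fin m) (Fin n) ℝ) (μ : Measure Ω) : Prop where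
  law : ∀ i j, HasLaw (fun ω => A ω i j) (gaussianReal 0 (1 / (m : ℝ≥0))) μ
  indep : iIndepFun (fun (p : Fin m × Fin n) (ω : Ω) => A ω p.1 p.2) μ

/-!
The proof is a net argument. For a fixed unit vector `x`, the coordinates of `A x` are independent
with law `N(0, 1/m)`, so the Chernoff method with the Laplace transform of a squared Gaussian
controls both tails of `‖A_I x‖²`. The upper tail is needed only for `I = [m]`, since `‖A_I x‖²`
increases with `I`. For the lower tail, the probability that the squares of `m / 2` given
coordinates sum to at most a small level is smaller than `2 ^ (-m)` by an exponential factor when the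
level is small enough, and hence the bound holds for all `I` with `|I| ≥ m / 2` at once. Together:
`‖A x‖² ≤ 3 / 2` and `‖A_I x‖² ≥ 1 / 400` for all these `I`, outside an event of probability
`2 exp (-m / 50)` (`IsGaussianMatrix.measureReal_not_netBounds_le`).

With `s = min n ⌊t k⌋`, each vector with at most `t k` nonzero entries lies in one of the
`n.choose s` coordinate subspaces of dimension `s`, and the unit sphere of each has a `1 / 100`-net
with at most `201 ^ s` points, by volume comparison (`exists_net_unit_sphere`). Bounds on the net
extend to the subspace at the price of slightly worse levels, `8 / 5` and `1 / 1600`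
(`norm_sq_bounds_of_net`). The nets contain together at most `exp (7 t k log (e n / k))` points
(`choose_le_exp_mul_log`), which the tail `exp (-m / 50)` absorbs once `m ≥ 800 t k log (e n / k)`.
If `n ≥ 2 k`, then `log (e n / k) ≤ 3 log (n / k)`, which gives the second form of the condition
on `m`, with the constant `2400`.
-/

/-! ### Nets in finite-dimensional normed spaces -/

open scoped Function in
/-- Volume comparison: the balls of radius `ε / 2` around `ε`-separated points of the unit ball are
disjoint and lie in the ball of radius `1 + ε / 2`. -/
theorem card_le_pow_finrank_of_separated {E : Type*} [NormedAddCommGroup E] [NormedSpace ℝ E]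
    [FiniteDimensional ℝ E] {ε : ℝ} (hε : 0 < ε) (s : Finset E) (hs : ∀ y ∈ s, ‖y‖ ≤ 1)
    (h : ∀ y ∈ s, ∀ z ∈ s, y ≠ z → ε ≤ ‖y - z‖) :
    (s.card : ℝ) ≤ (1 + 2 / ε) ^ Module.finrank ℝ E := by
  borelize E
  let μ : Measure E := Measure.addHaar
  have hδ : 0 < ε / 2 := by positivity
  have hρ : 0 < 1 + ε / 2 := by positivity
  have hd : Set.Pairwise (s : Set E) (Disjoint on fun c => Metric.ball c (ε / 2)) := by
    rintro c hc d hd hcd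
    apply Metric.ball_disjoint_ball
    rw [dist_eq_norm, add_halves]
    exact h c hc d hd hcd
  have hsub : (⋃ c ∈ s, Metric.ball c (ε / 2)) ⊆ Metric.ball (0 : E) (1 + ε / 2) := by
    refine Set.iUnion₂_subset fun y hy => Metric.ball_subset_ball' ?_
    rw [dist_zero_right]
    linarith [hs y hy]
  have hvol : (s.card : ENNReal) * ENNReal.ofReal ((ε / 2) ^ Module.finrank ℝ E) *
      μ (Metric.ball 0 1) ≤
      ENNReal.ofReal ((1 + ε / 2) ^ Module.finrank ℝ E) * μ (Metric.ball 0 1) :=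
    calc
      _ = μ (⋃ c ∈ s, Metric.ball c (ε / 2)) := by
        rw [measure_biUnion_finset hd fun c _ => measurableSet_ball]
        simp only [μ.addHaar_ball_of_pos _ hδ, Finset.sum_const, nsmul_eq_mul, mul_assoc]
      _ ≤ μ (Metric.ball (0 : E) (1 + ε / 2)) := measure_mono hsub
      _ = _ := by simp only [μ.addHaar_ball_of_pos _ hρ]
  have hcard := (ENNReal.mul_le_mul_iff_left
    (Metric.measure_ball_pos _ _ zero_lt_one).ne' measure_ball_lt_top.ne).1 hvol
  have hreal := ENNReal.toReal_le_of_le_ofReal (pow_nonneg hρ.le _) hcard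
  rw [ENNReal.toReal_mul, ENNReal.toReal_natCast, ENNReal.toReal_ofReal (by positivity),
    ← le_div_iff₀ (by positivity), ← div_pow] at hreal
  rwa [show 1 + 2 / ε = (1 + ε / 2) / (ε / 2) by field_simp; ring]

/-- The unit sphere of a finite-dimensional space has an `ε`-net of cardinality at most
`(1 + 2 / ε) ^ dim`: any `ε`-separated subset of maximal cardinality is one. -/
theorem exists_net_unit_sphere (E : Type*) [NormedAddCommGroup E] [NormedSpace ℝ E]
    [FiniteDimensional ℝ E] {ε : ℝ} (hε : 0 < ε) :
    ∃ N : Finset E, (∀ y ∈ N, ‖y‖ = 1) ∧ (∀ x : E, ‖x‖ = 1 → ∃ y ∈ N, ‖x - y‖ ≤ ε) ∧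
      (N.card : ℝ) ≤ (1 + 2 / ε) ^ Module.finrank ℝ E := by
  classical
  let P : ℕ → Prop := fun k => ∃ N : Finset E, (∀ y ∈ N, ‖y‖ = 1) ∧
    (∀ y ∈ N, ∀ z ∈ N, y ≠ z → ε ≤ ‖y - z‖) ∧ N.card = k
  have hle : ∀ k, P k → k ≤ ⌊(1 + 2 / ε) ^ Module.finrank ℝ E⌋₊ := by
    rintro k ⟨N, h1, h2, rfl⟩
    exact Nat.le_floor (card_le_pow_finrank_of_separated hε N (fun y hy => (h1 y hy).le) h2)
  have h0 : P 0 := ⟨∅, by simp⟩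
  obtain ⟨N, h1, h2, h3⟩ := Nat.findGreatest_spec (P := P) (Nat.zero_le _) h0
  refine ⟨N, h1, fun x hx => ?_,
    card_le_pow_finrank_of_separated hε N (fun y hy => (h1 y hy).le) h2⟩
  by_contra! hcon
  have hxN : x ∉ N := fun hxN => by simpa [hε.not_gt] using hcon x hxN
  have hP : P (N.card + 1) := by
    refine ⟨insert x N, ?_, ?_, Finset.card_insert_of_notMem hxN⟩
    · simpa [hx] using h1
    · intro y hy z hz hyz
      rcases Finset.mem_insert.1 hy with hy' | hy' <;> rcases Finset.mem_insert.1 hz with hz' | hz'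
      · exact absurd (hy'.trans hz'.symm) hyz
      · exact hy' ▸ (hcon z hz').le
      · rw [norm_sub_rev]
        exact hz' ▸ (hcon y hy').le
      · exact h2 y hy' z hz' hyz
  have hmax : N.card + 1 ≤ Nat.findGreatest P _ := Nat.le_findGreatest (hle _ hP) hP
  rw [← h3] at hmax
  exact Nat.not_succ_le_self _ hmax

/-- Bounds on a `1 / 100`-net of the unit sphere for a pair of linear maps with `‖g v‖ ≤ ‖f v‖`
extend to the whole space. The operator norm of `f` is at most `√(3/2) + ‖f‖ / 100`, and moving from
a point of the sphere to the net changes `g` by at most `‖f‖ / 100`. -/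
theorem norm_sq_bounds_of_net {E F G : Type*} [NormedAddCommGroup E] [NormedSpace ℝ E]
    [NormedAddCommGroup F] [NormedSpace ℝ F] [NormedAddCommGroup G] [NormedSpace ℝ G]
    (f : E →L[ℝ] F) (g : E →L[ℝ] G) (hgf : ∀ v, ‖g v‖ ≤ ‖f v‖) {N : Set E}
    (hN : ∀ x : E, ‖x‖ = 1 → ∃ y ∈ N, ‖x - y‖ ≤ 1 / 100)
    (hf : ∀ y ∈ N, ‖f y‖ ^ 2 ≤ 3 / 2) (hg : ∀ y ∈ N, 1 / 400 ≤ ‖g y‖ ^ 2) (x : E) :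
    1 / 1600 * ‖x‖ ^ 2 ≤ ‖g x‖ ^ 2 ∧ ‖f x‖ ^ 2 ≤ 8 / 5 * ‖x‖ ^ 2 := by
  have hM : ‖f‖ ≤ 5 / 4 := by
    have hstep : ‖f‖ ≤ 49 / 40 + ‖f‖ * (1 / 100) := by
      refine ContinuousLinearMap.opNorm_le_of_unit_norm (by positivity) fun x hx => ?_
      obtain ⟨y, hy, hxy⟩ := hN x hx
      have h1 : ‖f y‖ ≤ 49 / 40 := by
        refine abs_le_of_sq_le_sq' ((hf y hy).trans (by norm_num)) (by norm_num) |>.2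
      have h2 : ‖f (x - y)‖ ≤ ‖f‖ * (1 / 100) := f.le_opNorm_of_le hxy
      calc ‖f x‖ = ‖f y + f (x - y)‖ := by rw [← map_add, add_sub_cancel]
        _ ≤ _ := (norm_add_le _ _).trans (add_le_add h1 h2)
    linarith
  have hlow : ∀ u : E, ‖u‖ = 1 → 1 / 40 ≤ ‖g u‖ := by
    intro u hu
    obtain ⟨y, hy, huy⟩ := hN u hu
    have h1 : 1 / 20 ≤ ‖g y‖ :=
      abs_le_of_sq_le_sq' (by norm_num; linarith [hg y hy]) (norm_nonneg _) |>.2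
    have h2 : ‖g (u - y)‖ ≤ 1 / 80 := by
      refine (hgf _).trans ((f.le_opNorm_of_le huy).trans ?_)
      linarith
    have h3 : ‖g y‖ ≤ ‖g u‖ + ‖g (u - y)‖ := by
      calc ‖g y‖ = ‖g u - g (u - y)‖ := by rw [← map_sub, sub_sub_cancel]
        _ ≤ _ := norm_sub_le _ _
    linarith
  constructor
  · rcases eq_or_ne x 0 with rfl | hx
    · simp
    have hx' : 0 < ‖x‖ := norm_pos_iff.2 hx
    have h := hlow (‖x‖⁻¹ • x) (norm_smul_inv_norm hx)
    rw [map_smul, norm_smul, norm_inv, norm_norm, ← div_eq_inv_mul, le_div_iff₀ hx'] at h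
    calc 1 / 1600 * ‖x‖ ^ 2 = (1 / 40 * ‖x‖) ^ 2 := by ring
      _ ≤ _ := by gcongr
  · have h := f.le_of_opNorm_le hM x
    calc ‖f x‖ ^ 2 ≤ (5 / 4 * ‖x‖) ^ 2 := by gcongr
      _ ≤ _ := by nlinarith [sq_nonneg ‖x‖]

/-! ### The law of `A x` and Laplace transforms -/

theorem rowNormSq_eq_sum {m n : ℕ} (A : Matrix (Fin m) (Fin n) ℝ) (I : Finset (Fin m))
    (x : EuclideanSpace ℝ (Fin n)) : rowNormSq A I x = ∑ i ∈ I, (∑ j, A i j * x j) ^ 2 := by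
  rw [rowNormSq, EuclideanSpace.real_norm_sq_eq, ← Finset.sum_coe_sort I]
  rfl

section GaussianTails

variable {Ω : Type*} [MeasurableSpace Ω] {μ : Measure Ω} {m n : ℕ}
  {A : Ω → Matrix (Fin m) (Fin n) ℝ}

theorem IsGaussianMatrix.memLp_entry (hA : IsGaussianMatrix A μ) (i : Fin m) (j : Fin n) :
    MemLp (fun ω => A ω i j) 2 μ :=
  (hA.law i j).hasGaussianLaw.memLp_two

theorem IsGaussianMatrix.covariance_entry (hA : IsGaussianMatrix A μ) (p q : Fin m × Fin n) :
    cov[fun ω => A ω p.1 p.2, fun ω => A ω q.1 q.2; μ] = if p = q then 1 / (m : ℝ) else 0 := by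
  split_ifs with h
  · subst h
    rw [covariance_self (hA.law _ _).aemeasurable, (hA.law _ _).variance_eq,
      variance_id_gaussianReal]
    simp
  · exact (hA.indep.indepFun h).covariance_eq_zero (hA.memLp_entry _ _) (hA.memLp_entry _ _)

theorem IsGaussianMatrix.covariance_mulVec [IsProbabilityMeasure μ] (hA : IsGaussianMatrix A μ)
    (x : EuclideanSpace ℝ (Fin n)) (i i' : Fin m) :
    cov[fun ω => ∑ j, A ω i j * x j, fun ω => ∑ j, A ω i' j * x j; μ] =
      if i = i' then ‖x‖ ^ 2 / m else 0 := by
  rw [covariance_fun_sum_fun_sum (fun j => (hA.memLp_entry i j).mul_const _)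
    (fun j => (hA.memLp_entry i' j).mul_const _)]
  simp_rw [covariance_mul_const_left, covariance_mul_const_right]
  have h := fun j j' => hA.covariance_entry (i, j) (i', j')
  simp only [Prod.mk.injEq] at h
  simp_rw [h]
  split_ifs with hi
  · simp only [hi, true_and, ite_mul, zero_mul, Finset.sum_ite_eq, Finset.mem_univ, if_true]
    rw [EuclideanSpace.real_norm_sq_eq, Finset.sum_div]
    exact Finset.sum_congr rfl fun j _ => by ring
  · simp [hi]

theorem IsGaussianMatrix.hasGaussianLaw_mulVec (hA : IsGaussianMatrix A μ)
    (x : EuclideanSpace ℝ (Fin n)) :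
    HasGaussianLaw (fun ω i => ∑ j, A ω i j * x j) μ := by
  have h := iIndepFun.hasGaussianLaw (fun p : Fin m × Fin n => (hA.law p.1 p.2).hasGaussianLaw)
    hA.indep
  exact h.map_fun (LinearMap.toContinuousLinearMap
    (LinearMap.pi fun i => ∑ j, x j • LinearMap.proj (i, j))) |>.congr (by
      filter_upwards with ω
      ext i
      simp [mul_comm])

/-- The coordinates of `A x` are uncorrelated and jointly Gaussian, hence independent. -/
theorem IsGaussianMatrix.iIndepFun_mulVec [IsProbabilityMeasure μ] (hA : IsGaussianMatrix A μ)
    (x : EuclideanSpace ℝ (Fin n)) :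
    iIndepFun (fun (i : Fin m) (ω : Ω) => ∑ j, A ω i j * x j) μ :=
  (hA.hasGaussianLaw_mulVec x).iIndepFun_of_covariance_eq_zero fun i i' h => by
    rw [hA.covariance_mulVec, if_neg h]

theorem IsGaussianMatrix.hasLaw_mulVec [IsProbabilityMeasure μ] (hA : IsGaussianMatrix A μ)
    (x : EuclideanSpace ℝ (Fin n)) (i : Fin m) :
    HasLaw (fun ω => ∑ j, A ω i j * x j) (gaussianReal 0 (‖x‖ ^ 2 / m).toNNReal) μ := by
  have hG := (hA.hasGaussianLaw_mulVec x).eval i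
  refine ⟨hG.aemeasurable, ?_⟩
  rw [IsGaussian.eq_gaussianReal _ hG.isGaussian_map, variance_map aemeasurable_id hG.aemeasurable,
    integral_map hG.aemeasurable aestronglyMeasurable_id]
  congr 1
  · simp only [id]
    rw [integral_finsetSum _ fun j _ => ((hA.memLp_entry i j).integrable one_le_two).mul_const _]
    refine Finset.sum_eq_zero fun j _ => ?_
    rw [integral_mul_const, (hA.law i j).integral_eq, integral_id_gaussianReal, zero_mul]
  · rw [Function.id_comp, ← covariance_self hG.aemeasurable, hA.covariance_mulVec, if_pos rfl]

/-- The Laplace transform of the square of a centred Gaussian. -/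
theorem integral_exp_mul_sq_gaussianReal {v : ℝ≥0} (hv : v ≠ 0) {t : ℝ} (ht : 2 * t * v < 1) :
    ∫ y, Real.exp (t * y ^ 2) ∂gaussianReal 0 v = (√(1 - 2 * t * v))⁻¹ := by
  have hv' : (0 : ℝ) < v := by positivity
  rw [integral_gaussianReal_eq_integral_smul hv]
  have h : ∀ y : ℝ, gaussianPDFReal 0 v y • Real.exp (t * y ^ 2) =
      (√(2 * Real.pi * v))⁻¹ * Real.exp (-((1 - 2 * t * v) / (2 * v)) * y ^ 2) := by
    intro y
    rw [gaussianPDFReal, smul_eq_mul, mul_assoc, ← Real.exp_add]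
    congr 2
    field_simp
    ring
  simp_rw [h]
  rw [integral_const_mul, integral_gaussian, ← Real.sqrt_inv, ← Real.sqrt_inv,
    ← Real.sqrt_mul (by positivity)]
  congr 1
  have : 1 - 2 * t * v ≠ 0 := by linarith
  field_simp

theorem integrable_exp_mul_sq_gaussianReal {v : ℝ≥0} (hv : v ≠ 0) {t : ℝ} (ht : 2 * t * v < 1) :
    Integrable (fun y => Real.exp (t * y ^ 2)) (gaussianReal 0 v) := by
  refine .of_integral_ne_zero ?_
  rw [integral_exp_mul_sq_gaussianReal hv ht]
  have : 0 < 1 - 2 * t * v := by linarith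
  positivity

/-- The moment generating function of `‖A_I x‖²` for a unit vector `x`, at `u * m`. -/
theorem IsGaussianMatrix.mgf_rowNormSq [IsProbabilityMeasure μ] (hA : IsGaussianMatrix A μ)
    (hm : 0 < m) {x : EuclideanSpace ℝ (Fin n)} (hx : ‖x‖ = 1) (I : Finset (Fin m))
    {u : ℝ} (hu : 2 * u < 1) :
    mgf (fun ω => rowNormSq (A ω) I x) μ (u * m) = (√(1 - 2 * u))⁻¹ ^ I.card ∧
      Integrable (fun ω => Real.exp (u * m * rowNormSq (A ω) I x)) μ := by
  have hm' : (0 : ℝ) < m := by exact_mod_cast hm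
  set Y : Fin m → Ω → ℝ := fun i ω => (∑ j, A ω i j * x j) ^ 2 with hY
  have hlaw := fun i => hA.hasLaw_mulVec x i
  rw [hx] at hlaw
  have hv : ((1 : ℝ) ^ 2 / m).toNNReal ≠ 0 := by
    rw [Ne, Real.toNNReal_eq_zero, not_le]
    positivity
  have hcoe : (((1 : ℝ) ^ 2 / m).toNNReal : ℝ) = 1 / m := by
    rw [Real.coe_toNNReal _ (by positivity), one_pow]
  have hu' : 2 * (u * m) * ((1 : ℝ) ^ 2 / m).toNNReal = 2 * u := by
    rw [hcoe]
    field_simp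
  have hYind : iIndepFun Y μ := (hA.iIndepFun_mulVec x).comp (fun _ y => y ^ 2) (by fun_prop)
  have hYm : ∀ i, AEMeasurable (Y i) μ := fun i => (hlaw i).aemeasurable.pow_const 2
  have hmgf : ∀ i, mgf (Y i) μ (u * m) = (√(1 - 2 * u))⁻¹ := by
    intro i
    rw [← hu', ← integral_exp_mul_sq_gaussianReal hv (hu'.trans_lt hu),
      ← (hlaw i).map_eq, integral_map (hlaw i).aemeasurable (by fun_prop)]
    rfl
  have hsum : (fun ω => rowNormSq (A ω) I x) = ∑ i ∈ I, Y i := by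
    ext ω
    rw [rowNormSq_eq_sum, Finset.sum_apply]
  have hval : mgf (∑ i ∈ I, Y i) μ (u * m) = (√(1 - 2 * u))⁻¹ ^ I.card := by
    rw [hYind.mgf_sum₀ hYm, Finset.prod_congr rfl fun i _ => hmgf i, Finset.prod_const]
  have hpos : 0 < 1 - 2 * u := by linarith
  refine ⟨hsum ▸ hval, .of_integral_ne_zero ?_⟩
  have : mgf (∑ i ∈ I, Y i) μ (u * m) ≠ 0 := by
    rw [hval]
    positivity
  rwa [← hsum] at this

end GaussianTails

/-! ### Tail bounds for a fixed vector -/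

section Tails

variable {Ω : Type*} [MeasurableSpace Ω] {μ : Measure Ω} [IsProbabilityMeasure μ] {m n : ℕ}
  {A : Ω → Matrix (Fin m) (Fin n) ℝ}

theorem IsGaussianMatrix.measureReal_rowNormSq_univ_ge_le (hA : IsGaussianMatrix A μ) (hm : 0 < m)
    {x : EuclideanSpace ℝ (Fin n)} (hx : ‖x‖ = 1) :
    μ.real {ω | 3 / 2 ≤ rowNormSq (A ω) Finset.univ x} ≤ Real.exp (-m / 50) := by
  -- `u = 1 / 6` minimizes the Chernoff bound at the level `3 / 2`
  obtain ⟨hmgf, hint⟩ := hA.mgf_rowNormSq hm hx Finset.univ (u := 1 / 6) (by norm_num)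
  refine (measure_ge_le_exp_mul_mgf (3 / 2) (by positivity) hint).trans ?_
  have hsqrt : (√(1 - 2 * (1 / 6)))⁻¹ ≤ Real.exp (23 / 100) := by
    rw [← Real.sqrt_inv, Real.sqrt_le_left (by positivity)]
    have h := Real.quadratic_le_exp_of_nonneg (x := 23 / 100) (by norm_num)
    calc _ ≤ (1 + 23 / 100 + (23 / 100) ^ 2 / 2 : ℝ) ^ 2 := by norm_num
      _ ≤ _ := by gcongr
  rw [hmgf, Finset.card_univ, Fintype.card_fin]
  calc _ ≤ Real.exp (-(1 / 6 * m) * (3 / 2)) * Real.exp (23 / 100) ^ m := by gcongr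
    _ = _ := by
      rw [← Real.exp_nat_mul, ← Real.exp_add]
      ring_nf

theorem IsGaussianMatrix.measureReal_rowNormSq_le_le (hA : IsGaussianMatrix A μ) (hm : 0 < m)
    {x : EuclideanSpace ℝ (Fin n)} (hx : ‖x‖ = 1) {I : Finset (Fin m)}
    (hI : (m : ℝ) / 2 ≤ I.card) :
    μ.real {ω | rowNormSq (A ω) I x ≤ 1 / 400} ≤ Real.exp (8 / 25) ^ m * (1 / 4) ^ m := by
  -- the value of `u` makes the factor contributed by each row equal to `1 / 16`
  obtain ⟨hmgf, hint⟩ := hA.mgf_rowNormSq hm hx I (u := -(255 / 2)) (by norm_num)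
  have ht : -(255 / 2) * (m : ℝ) ≤ 0 := by
    have : (0 : ℝ) ≤ m := by positivity
    linarith
  refine (measure_le_le_exp_mul_mgf (1 / 400) ht hint).trans ?_
  rw [hmgf, show (1 - 2 * -(255 / 2) : ℝ) = 16 ^ 2 by norm_num, Real.sqrt_sq (by norm_num),
    ← Real.exp_nat_mul]
  gcongr ?_ * ?_
  · rw [Real.exp_le_exp]
    have : (0 : ℝ) ≤ m := by positivity
    linarith
  · have h2 : m ≤ 2 * I.card := by
      have : (m : ℝ) ≤ 2 * I.card := by linarith
      exact_mod_cast this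
    calc ((16 : ℝ)⁻¹) ^ I.card = (1 / 4) ^ (2 * I.card) := by
          rw [pow_mul]
          norm_num
      _ ≤ _ := pow_le_pow_of_le_one (by norm_num) (by norm_num) h2

/-- The lower tail survives the union bound over all sets `I` of rows, of which there are at most
`2 ^ m`: the level `1 / 400` is so small that each event has probability well below `2 ^ (-m)`. -/
theorem IsGaussianMatrix.measureReal_exists_rowNormSq_le_le (hA : IsGaussianMatrix A μ)
    (hm : 0 < m) {x : EuclideanSpace ℝ (Fin n)} (hx : ‖x‖ = 1) :
    μ.real {ω | ∃ I : Finset (Fin m), (m : ℝ) / 2 ≤ I.card ∧ rowNormSq (A ω) I x ≤ 1 / 400} ≤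
      Real.exp (-m / 50) := by
  classical
  set S : Finset (Finset (Fin m)) := Finset.univ.filter fun I => (m : ℝ) / 2 ≤ I.card
  have hS : (S.card : ℝ) ≤ 2 ^ m := by
    have h := Finset.card_filter_le (Finset.univ : Finset (Finset (Fin m)))
      fun I => (m : ℝ) / 2 ≤ I.card
    rw [Finset.card_univ, Fintype.card_finset, Fintype.card_fin] at h
    exact_mod_cast h
  have hset : {ω | ∃ I : Finset (Fin m), (m : ℝ) / 2 ≤ I.card ∧ rowNormSq (A ω) I x ≤ 1 / 400} =
      ⋃ I ∈ S, {ω | rowNormSq (A ω) I x ≤ 1 / 400} := by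
    ext ω
    simp [S]
  have hbase : 2 * (Real.exp (8 / 25) * (1 / 4)) ≤ Real.exp (-1 / 50) := by
    have h : Real.exp (17 / 50) ≤ 2 := by
      rw [← Real.le_log_iff_exp_le (by norm_num)]
      linarith [Real.log_two_gt_d9]
    have h' : Real.exp (8 / 25) = Real.exp (-1 / 50) * Real.exp (17 / 50) := by
      rw [← Real.exp_add]
      norm_num
    nlinarith [Real.exp_pos (-1 / 50)]
  rw [hset]
  calc _ ≤ ∑ I ∈ S, μ.real {ω | rowNormSq (A ω) I x ≤ 1 / 400} := measureReal_biUnion_finset_le _ _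
    _ ≤ ∑ I ∈ S, Real.exp (8 / 25) ^ m * (1 / 4) ^ m := Finset.sum_le_sum fun I hI =>
        hA.measureReal_rowNormSq_le_le hm hx (Finset.mem_filter.1 hI).2
    _ ≤ 2 ^ m * (Real.exp (8 / 25) ^ m * (1 / 4) ^ m) := by
        rw [Finset.sum_const, nsmul_eq_mul]
        gcongr
    _ = (2 * (Real.exp (8 / 25) * (1 / 4))) ^ m := by rw [mul_pow, mul_pow]
    _ ≤ Real.exp (-1 / 50) ^ m := by gcongr
    _ = _ := by
        rw [← Real.exp_nat_mul]
        ring_nf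

end Tails

/-- The bounds imposed on `B` at a point `y` of the net: `‖B y‖² ≤ 3 / 2`, and `‖B_I y‖² ≥ 1 / 400`
for every set `I` of at least half of the rows. -/
def NetBounds {m n : ℕ} (B : Matrix (Fin m) (Fin n) ℝ) (y : EuclideanSpace ℝ (Fin n)) : Prop :=
  rowNormSq B Finset.univ y ≤ 3 / 2 ∧
    ∀ I : Finset (Fin m), (m : ℝ) / 2 ≤ I.card → 1 / 400 ≤ rowNormSq B I y

theorem IsGaussianMatrix.measureReal_not_netBounds_le {Ω : Type*} [MeasurableSpace Ω]
    {μ : Measure Ω} [IsProbabilityMeasure μ] {m n : ℕ} {A : Ω → Matrix (Fin m) (Fin n) ℝ}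
    (hA : IsGaussianMatrix A μ) (hm : 0 < m) {x : EuclideanSpace ℝ (Fin n)} (hx : ‖x‖ = 1) :
    μ.real {ω | ¬ NetBounds (A ω) x} ≤ 2 * Real.exp (-m / 50) := by
  have hsub : {ω | ¬ NetBounds (A ω) x} ⊆ {ω | 3 / 2 ≤ rowNormSq (A ω) Finset.univ x} ∪
      {ω | ∃ I : Finset (Fin m), (m : ℝ) / 2 ≤ I.card ∧ rowNormSq (A ω) I x ≤ 1 / 400} := by
    intro ω hω
    by_contra hcon
    simp only [Set.mem_union, Set.mem_ofPred_eq, not_or, not_exists, not_and, not_le] at hcon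
    exact hω ⟨hcon.1.le, fun I hI => (hcon.2 I hI).le⟩
  refine (measureReal_mono hsub).trans ((measureReal_union_le _ _).trans ?_)
  rw [two_mul]
  exact add_le_add (hA.measureReal_rowNormSq_univ_ge_le hm hx)
    (hA.measureReal_exists_rowNormSq_le_le hm hx)

/-! ### Passage from nets to all sparse vectors -/

/-- A finite set of unit vectors on which the bounds need to be checked: the union of the
`1 / 100`-nets of the unit spheres of all `s`-dimensional coordinate subspaces. -/
theorem exists_finset_srip_of_netBounds (m : ℕ) {n s : ℕ} (hs : s ≤ n) :
    ∃ N : Finset (EuclideanSpace ℝ (Fin n)), (∀ y ∈ N, ‖y‖ = 1) ∧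
      (N.card : ℝ) ≤ n.choose s * 201 ^ s ∧
      ∀ B : Matrix (Fin m) (Fin n) ℝ, (∀ y ∈ N, NetBounds B y) → SRIP B s (1 / 1600) (8 / 5) := by
  classical
  let W : Finset (Fin n) → Submodule ℝ (EuclideanSpace ℝ (Fin n)) := fun T =>
    Submodule.span ℝ (T.image fun j => EuclideanSpace.single j (1 : ℝ))
  choose N hN1 hN2 hN3 using fun T => exists_net_unit_sphere (W T) (ε := 1 / 100) (by norm_num)
  have hdim : ∀ T, Module.finrank ℝ (W T) ≤ T.card := fun T =>
    (finrank_span_finset_le_card _).trans Finset.card_image_le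
  have hmem : ∀ (T : Finset (Fin n)) (x : EuclideanSpace ℝ (Fin n)),
      (Finset.univ.filter fun j => x j ≠ 0) ⊆ T → x ∈ W T := by
    intro T x hx
    rw [← (EuclideanSpace.basisFun (Fin n) ℝ).sum_repr x]
    refine Submodule.sum_mem _ fun j _ => ?_
    rw [EuclideanSpace.basisFun_repr, EuclideanSpace.basisFun_apply]
    by_cases hj : x j = 0
    · simp [hj]
    · refine Submodule.smul_mem _ _ (Submodule.subset_span ?_)
      exact Finset.mem_coe.2 (Finset.mem_image_of_mem _ (hx (by simpa using hj)))
  refine ⟨(Finset.powersetCard s Finset.univ).biUnion fun T => (N T).image Subtype.val, ?_, ?_, ?_⟩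
  · intro y hy
    obtain ⟨T, -, hy⟩ := Finset.mem_biUnion.1 hy
    obtain ⟨z, hz, rfl⟩ := Finset.mem_image.1 hy
    exact hN1 T z hz
  · have h : ∀ T ∈ Finset.powersetCard s (Finset.univ : Finset (Fin n)),
        (((N T).image Subtype.val).card : ℝ) ≤ 201 ^ s := by
      intro T hT
      calc (((N T).image Subtype.val).card : ℝ) ≤ (N T).card := by
            exact_mod_cast Finset.card_image_le
        _ ≤ _ := hN3 T
        _ = (201 : ℝ) ^ Module.finrank ℝ (W T) := by norm_num
        _ ≤ _ := pow_le_pow_right₀ (by norm_num)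
            ((hdim T).trans (Finset.mem_powersetCard.1 hT).2.le)
    calc _ ≤ ∑ T ∈ Finset.powersetCard s (Finset.univ : Finset (Fin n)),
          (((N T).image Subtype.val).card : ℝ) := by exact_mod_cast Finset.card_biUnion_le
      _ ≤ _ := Finset.sum_le_sum h
      _ = _ := by simp
  · intro B hB
    refine ⟨by norm_num, by norm_num, fun x hx I hI => ?_⟩
    obtain ⟨T, hT, -, hTs⟩ := Finset.exists_subsuperset_card_eq
      (Finset.subset_univ (Finset.univ.filter fun j => x j ≠ 0)) (Nat.cast_le.1 hx)
      (by simpa using hs)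
    let f : ∀ I : Finset (Fin m), W T →ₗ[ℝ] EuclideanSpace ℝ I := fun I =>
      (Matrix.toLpLin 2 2 (rowSubmatrix B I)).comp (W T).subtype
    have hmono : ∀ v : EuclideanSpace ℝ (Fin n),
        rowNormSq B I v ≤ rowNormSq B Finset.univ v := fun v => by
      rw [rowNormSq_eq_sum, rowNormSq_eq_sum]
      exact Finset.sum_le_sum_of_subset_of_nonneg (Finset.subset_univ _) fun _ _ _ => sq_nonneg _
    have hgood : ∀ y ∈ N T, NetBounds B y := fun y hy => hB _ <|
      Finset.mem_biUnion.2 ⟨T, Finset.mem_powersetCard.2 ⟨Finset.subset_univ _, hTs⟩,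
        Finset.mem_image_of_mem _ hy⟩
    obtain ⟨h1, h2⟩ := norm_sq_bounds_of_net (LinearMap.toContinuousLinearMap (f Finset.univ))
      (LinearMap.toContinuousLinearMap (f I))
      (fun v => abs_le_of_sq_le_sq' (hmono v) (norm_nonneg _) |>.2) (N := N T) (hN2 T)
      (fun y hy => (hgood y hy).1) (fun y hy => (hgood y hy).2 I hI) ⟨x, hmem T x hT⟩
    exact ⟨h1, (hmono x).trans h2⟩

/-! ### Counting and the union bound -/

theorem choose_le_exp_mul_log {n s : ℕ} (hs : 1 ≤ s) (hsn : s ≤ n) :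
    (n.choose s : ℝ) ≤ Real.exp (s * Real.log (Real.exp 1 * n / s)) := by
  have hs' : (0 : ℝ) < s := by exact_mod_cast hs
  have hn' : (0 : ℝ) < n := by exact_mod_cast hs.trans hsn
  rw [Real.exp_nat_mul, Real.exp_log (by positivity)]
  calc (n.choose s : ℝ) ≤ n ^ s / s.factorial := Nat.choose_le_pow_div s n
    _ = (n / s) ^ s * (s ^ s / s.factorial) := by
        rw [div_pow]
        field_simp
    _ ≤ (n / s) ^ s * Real.exp s := by
        gcongr
        exact Real.pow_div_factorial_le_exp _ hs'.le s
    _ = _ := by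
        rw [← mul_one (s : ℝ), Real.exp_nat_mul, mul_one, ← mul_pow]
        ring_nf

/-- The factor `n / k ≥ 2` makes `log (n / k)` comparable with `log (e n / k)`. -/
theorem log_exp_one_mul_div_le {n k : ℕ} (hk : 1 ≤ k) (h : 2 * k ≤ n) :
    Real.log (Real.exp 1 * n / k) ≤ 3 * Real.log (n / k) := by
  have hk' : (0 : ℝ) < k := by exact_mod_cast hk
  have hn : (2 * k : ℝ) ≤ n := by exact_mod_cast h
  have h2 : (2 : ℝ) ≤ n / k := by rwa [le_div_iff₀ hk']
  rw [mul_div_assoc, Real.log_mul (by positivity) (by positivity), Real.log_exp]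
  linarith [Real.log_le_log two_pos h2, Real.log_two_gt_d9]

theorem mainTheorem2 :
    ∃ θm θp c C : ℝ, 0 < θm ∧ θm < θp ∧ θp < 2 ∧ 0 < c ∧ 0 < C ∧
      ∀ (t : ℝ) (m n k : ℕ), 1 < t → 1 ≤ k → k ≤ n →
        (C * (t * k * Real.log (Real.exp 1 * n / k)) ≤ m ∨
          (2 * k ≤ n ∧ C * (t * k * Real.log (n / k)) ≤ m)) →
        ∀ (Ω : Type*) [MeasurableSpace Ω] (μ : Measure Ω) [IsProbabilityMeasure μ]
          (A : Ω → Matrix (Fin m) (Fin n) ℝ), IsGaussianMatrix A μ →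
          1 - Real.exp (-(c * m) / 2) ≤ μ.real {ω | SRIP (A ω) (t * k) θm θp} := by
  refine ⟨1 / 1600, 8 / 5, 1 / 50, 2400, by norm_num, by norm_num, by norm_num, by norm_num,
    by norm_num, fun t m n k ht hk hkn hm Ω _ μ _ A hA => ?_⟩
  have hk' : (1 : ℝ) ≤ k := by exact_mod_cast hk
  have hkn' : (k : ℝ) ≤ n := by exact_mod_cast hkn
  have hn' : (0 : ℝ) < n := by linarith
  have htk : (k : ℝ) ≤ t * k := by nlinarith
  set l := Real.log (Real.exp 1 * n / k) with hl
  have hl1 : 1 ≤ l := by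
    rw [hl, mul_div_assoc, Real.log_mul (by positivity) (by positivity), Real.log_exp]
    linarith [Real.log_nonneg ((one_le_div (by positivity)).2 hkn')]
  have hml : 800 * (t * k * l) ≤ m := by
    rcases hm with hm | ⟨h2, hm⟩
    · have : 0 ≤ t * k * l := by positivity
      linarith
    · have := mul_le_mul_of_nonneg_left (log_exp_one_mul_div_le hk h2)
        (show 0 ≤ t * k by positivity)
      linarith
  have hmpos : 0 < m := by
    have : (0 : ℝ) < m := lt_of_lt_of_le (by positivity) hml
    exact_mod_cast this
  -- a vector of `ℝⁿ` has at most `t * k` nonzero coordinates iff it has at most `s`; here `k ≤ s`,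
  -- so that `log (e n / s) ≤ l`, also when `t * k` exceeds `n`
  set s := min n ⌊t * k⌋₊ with hs
  have hks : k ≤ s := le_min hkn (Nat.le_floor htk)
  have hsn : s ≤ n := min_le_left _ _
  have hstk : (s : ℝ) ≤ t * k :=
    (Nat.cast_le.2 (min_le_right _ _)).trans (Nat.floor_le (by positivity))
  have hsparse : ∀ x : EuclideanSpace ℝ (Fin n), IsSparse (t * k) x → IsSparse s x := by
    intro x hx
    refine Nat.cast_le.2 (le_min ?_ (Nat.le_floor hx))
    simpa using Finset.card_le_univ (Finset.univ.filter fun j => x j ≠ 0)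
  obtain ⟨N, hN1, hNcard, hN⟩ := exists_finset_srip_of_netBounds m hsn
  have hcard : (N.card : ℝ) ≤ Real.exp (7 * (t * k * l)) := by
    have hchoose : (n.choose s : ℝ) ≤ Real.exp (t * k * l) := by
      refine (choose_le_exp_mul_log (hk.trans hks) hsn).trans (Real.exp_le_exp.2 ?_)
      have hlog : Real.log (Real.exp 1 * n / s) ≤ l := by
        have : (k : ℝ) ≤ s := by exact_mod_cast hks
        have : (0 : ℝ) < s := by linarith
        refine Real.log_le_log (by positivity) ?_
        gcongr
      exact (mul_le_mul_of_nonneg_left hlog (by positivity)).trans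
        (mul_le_mul_of_nonneg_right hstk (by positivity))
    have hpow : (201 : ℝ) ^ s ≤ Real.exp (6 * (t * k * l)) := by
      have h201 : (201 : ℝ) ≤ Real.exp 6 := by
        have h := Real.add_one_le_exp (1 : ℝ)
        have h' : Real.exp 6 = Real.exp 1 ^ 6 := by
          rw [← Real.exp_nat_mul]
          norm_num
        have := Real.exp_one_gt_d9
        rw [h']
        calc (201 : ℝ) ≤ 2.7 ^ 6 := by norm_num
          _ ≤ _ := by
            gcongr
            linarith
      calc (201 : ℝ) ^ s ≤ Real.exp 6 ^ s := by gcongr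
        _ = Real.exp (6 * s) := by rw [← Real.exp_nat_mul, mul_comm]
        _ ≤ _ := by
          rw [Real.exp_le_exp]
          have : (s : ℝ) * 1 ≤ t * k * l := mul_le_mul hstk hl1 zero_le_one (by positivity)
          linarith
    calc (N.card : ℝ) ≤ n.choose s * 201 ^ s := hNcard
      _ ≤ Real.exp (t * k * l) * Real.exp (6 * (t * k * l)) := by gcongr
      _ = _ := by
        rw [← Real.exp_add]
        ring_nf
  have hbad : μ.real (⋃ y ∈ N, {ω | ¬ NetBounds (A ω) y}) ≤ Real.exp (-(1 / 50 * m) / 2) := by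
    calc _ ≤ ∑ y ∈ N, μ.real {ω | ¬ NetBounds (A ω) y} := measureReal_biUnion_finset_le _ _
      _ ≤ ∑ y ∈ N, 2 * Real.exp (-m / 50) := Finset.sum_le_sum fun y hy =>
          hA.measureReal_not_netBounds_le hmpos (hN1 y hy)
      _ = N.card * (2 * Real.exp (-m / 50)) := by rw [Finset.sum_const, nsmul_eq_mul]
      _ ≤ Real.exp (7 * (t * k * l)) * (Real.exp 1 * Real.exp (-m / 50)) := by
          gcongr
          linarith [Real.add_one_le_exp (1 : ℝ)]
      _ ≤ _ := by
          rw [← Real.exp_add, ← Real.exp_add, Real.exp_le_exp]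
          have h1 : 1 * 1 ≤ t * k * l := mul_le_mul (hk'.trans htk) hl1 zero_le_one (by positivity)
          linarith
  have hcover : Set.univ ⊆ {ω | SRIP (A ω) (t * k) (1 / 1600) (8 / 5)} ∪
      ⋃ y ∈ N, {ω | ¬ NetBounds (A ω) y} := by
    intro ω _
    by_cases hω : ∀ y ∈ N, NetBounds (A ω) y
    · have h := hN (A ω) hω
      exact Or.inl ⟨h.lower_mem, h.upper_mem, fun x hx => h.bounds x (hsparse x hx)⟩
    · push Not at hω
      obtain ⟨y, hy, hyω⟩ := hω
      exact Or.inr (Set.mem_biUnion hy hyω)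
  have htotal := (measureReal_mono hcover (μ := μ)).trans (measureReal_union_le _ _)
  rw [probReal_univ] at htotal
  linarith
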